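/- Let $E$ be an elliptic curve over a number field $K$, let $\mathfrak p$ be a prime of $K$ lying above the rational prime $p$, and let $K_{\mathfrak p}$ be the completion. Let $v$ be the valuation of $\overline{K_{\mathfrak p}}$ with $v(p)=1$. Fix a minimal Weierstrass equation of $E$ over $K_{\mathfrak p}$, and let $\hat E$ be its formal group, identified with the group of points $Q\in E(\overline{K_{\mathfrak p}})$ that reduce to the point at infinity, via the parameter $Q\mapsto \hat Q=-x(Q)/y(Q)$ (and $\hat O=0$). Let $\hat E[{=}p]$ be the set of elements of exact order $p$ of $\hat E$. If there are $\hat R,\hat Q\in\hat E[{=}p]$ with $v(\hat R)>v(\hat Q)$, then the subgroup $\langle \hat R\rangle$ is called a canonical subgroup of $E$ at $\mathfrak p$; otherwise $E$ has no canonical subgroup at $\mathfrak p$. (1) If $E$ has good supersingular reduction at $\mathfrak p$ and $\mathfrak p$ is unramified over $p$ (ramification index $1$), then $E$ has no canonical subgroup at $\mathfrak p$. (2) No elliptic curve over $\mathbb Q$ has, in this sense, a canonical subgroup at any prime (whatever its reduction there). -/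

import Mathlib

open NumberField IsDedekindDomain

noncomputable section

namespace WeierstrassCurve

open scoped Classical in
/-- An elliptic curve over a field `k` of characteristic `p` is supersingular if it has no point of
order `p` over an algebraic closure of `k`. -/
def IsSupersingular {k : Type*} [Field k] (W : WeierstrassCurve k) (p : ℕ) : Prop :=
  W.IsElliptic ∧
    ∀ P : (W.baseChange (AlgebraicClosure k)).toAffine.Point, p • P = 0 → P = 0

section Local

variable {K : Type*} [Field K] [NumberField K] (E : WeierstrassCurve K)
  (𝔭 : HeightOneSpectrum (𝓞 K)) (p : ℕ)

/-- A minimal Weierstrass equation of `E` over the completion `K_𝔭`. -/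
def minimalAt : WeierstrassCurve (𝔭.adicCompletion K) :=
  (E.baseChange (𝔭.adicCompletion K)).minimal (𝔭.adicCompletionIntegers K)

instance : (E.minimalAt 𝔭).IsMinimal (𝔭.adicCompletionIntegers K) :=
  inferInstanceAs (((E.baseChange (𝔭.adicCompletion K)).minimal
    (𝔭.adicCompletionIntegers K)).IsMinimal (𝔭.adicCompletionIntegers K))

/-- `E` has good supersingular reduction at the prime `𝔭`, which lies above `p`: the reduction of
its minimal equation is a supersingular elliptic curve over the residue field. -/
def IsSupersingularAt : Prop :=
  (E.minimalAt 𝔭).HasGoodReduction (𝔭.adicCompletionIntegers K) ∧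
    ((E.minimalAt 𝔭).reduction (𝔭.adicCompletionIntegers K)).IsSupersingular p

/-- The field in which the torsion of the formal group lives: an algebraic closure of `K_𝔭`. -/
abbrev LocalClosure : Type _ := AlgebraicClosure (𝔭.adicCompletion K)

open scoped Classical in
/-- The valuation of the algebraic closure of `K_𝔭` that extends that of `K_𝔭` and is normalized by
`v p = 1`, for `𝔭` above `p`. It is additive, with `v 0 = ∞`. (The spectral norm is the extension of
the `𝔭`-adic absolute value.) -/
def valuationAt (z : LocalClosure 𝔭) : WithTop ℝ :=
  if z = 0 then ⊤
  else ((Real.logb ‖(p : 𝔭.adicCompletion K)‖ (spectralNorm (𝔭.adicCompletion K) (LocalClosure 𝔭) z) : ℝ) :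
    WithTop ℝ)

/-- The points over the algebraic closure of `K_𝔭` on the minimal equation of `E` at `𝔭`. -/
abbrev PointAt : Type _ := ((E.minimalAt 𝔭).baseChange (LocalClosure 𝔭)).toAffine.Point

variable {E 𝔭}

/-- The formal group `Ê`, as the kernel of reduction: a point belongs to it if it reduces to the
point at infinity, i.e. if `[x : y : 1] = [x / y : 1 : 1 / y]` reduces to `[0 : 1 : 0]`. -/
def PointAt.InFormalGroup : E.PointAt 𝔭 → Prop
  | .zero => True
  | .some x y _ => valuationAt 𝔭 p y < 0 ∧ valuationAt 𝔭 p y < valuationAt 𝔭 p x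

/-- The parameter `P̂ = -x(P) / y(P)` of a point of the formal group, an element of the maximal
ideal. -/
def PointAt.parameter : E.PointAt 𝔭 → LocalClosure 𝔭
  | .zero => 0
  | .some x y _ => -x / y

variable (E 𝔭)

open scoped Classical in
/-- The elements of exact order `p` of the formal group of `E` at `𝔭`. -/
def formalExactTorsion : Set (E.PointAt 𝔭) :=
  {P | P.InFormalGroup p ∧ addOrderOf P = p}

open scoped Classical in
/-- `C` is a canonical subgroup of `E` at `𝔭`: it is generated by a point `R` of exact order `p` of
the formal group whose parameter has strictly larger valuation than that of some other `Q` of exact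
order `p`. -/
def IsCanonicalSubgroup (C : AddSubgroup (E.PointAt 𝔭)) : Prop :=
  ∃ R ∈ E.formalExactTorsion 𝔭 p,
    (∃ Q ∈ E.formalExactTorsion 𝔭 p,
      valuationAt 𝔭 p Q.parameter < valuationAt 𝔭 p R.parameter) ∧
    C = AddSubgroup.zmultiples R

open scoped Classical in
/-- `E` has a canonical subgroup at `𝔭`, where `𝔭` lies above `p`. -/
def HasCanonicalSubgroup : Prop :=
  ∃ C : AddSubgroup (E.PointAt 𝔭), E.IsCanonicalSubgroup 𝔭 p C

end Local

end WeierstrassCurve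

end

/-! If `p` has the least positive valuation on the ring of integers `A`, the Newton polygon of
multiplication by `p` on the formal group has only one segment of positive slope: the linear
coefficient is `p`, and every other coefficient is a unit or at least as divisible as `p`. All
parameters of exact order `p` then have the same valuation, which leaves no room for a canonical
subgroup. Primes of `ℚ` are always unramified, so (2) follows as (1) does.

The power series is replaced by polynomials over `A` that approximate it modulo each power of `z`
(`HasExpansion`). To make one polynomial serve several points at once, their parameters are gathered
into one element `z` of a product of copies of the valuation ring; it lies in the Jacobson radical,
so all denominators in the group law are units. Comparing `(p - 1) • P` with `-P` gives an expansion
of `0` with linear coefficient `p` (`hasExpansion_zero_of_order`). The Newton polygon argument is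
`exists_pow_eq_of_linear_coeff`, and `valuation_parameter_eq` combines the two. -/

open Polynomial

/-- An element `g` of an `A`-algebra has an expansion in `z` with constant coefficient `a` and
linear coefficient `b` if it agrees modulo every power of `z` with a polynomial in `z` with these
two coefficients. -/
def HasExpansion {A B : Type*} [CommRing A] [CommRing B] [Algebra A B] (z g : B) (a b : A) : Prop :=
  ∀ N : ℕ, ∃ q : A[X], q.coeff 0 = a ∧ q.coeff 1 = b ∧ z ^ N ∣ g - aeval z q

/-! ### Arithmetic of expansions -/

namespace HasExpansion

variable {A B : Type*} [CommRing A] [CommRing B] [Algebra A B] {z g h : B} {a b c d : A}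

lemma congr (hg : HasExpansion z g a b) (hh : g = h) (ha : a = c) (hb : b = d) :
    HasExpansion z h c d := by
  subst hh ha hb
  exact hg

lemma const (z : B) (a : A) : HasExpansion z (algebraMap A B a) a 0 :=
  fun N ↦ ⟨C a, by simp, by simp, by simp⟩

lemma one (z : B) : HasExpansion z (1 : B) (1 : A) 0 :=
  (const z 1).congr (by simp) rfl rfl

lemma self (z : B) : HasExpansion z z (0 : A) 1 :=
  fun N ↦ ⟨X, by simp, by simp, by simp⟩

lemma add (hg : HasExpansion z g a b) (hh : HasExpansion z h c d) :
    HasExpansion z (g + h) (a + c) (b + d) := fun N ↦ by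
  obtain ⟨q, hq0, hq1, hq⟩ := hg N
  obtain ⟨r, hr0, hr1, hr⟩ := hh N
  refine ⟨q + r, by simp [*], by simp [*], ?_⟩
  convert dvd_add hq hr using 1
  rw [map_add]
  ring

lemma mul (hg : HasExpansion z g a b) (hh : HasExpansion z h c d) :
    HasExpansion z (g * h) (a * c) (a * d + b * c) := fun N ↦ by
  obtain ⟨q, hq0, hq1, hq⟩ := hg N
  obtain ⟨r, hr0, hr1, hr⟩ := hh N
  refine ⟨q * r, by simp [mul_coeff_zero, *], by simp [mul_coeff_one, *], ?_⟩
  convert dvd_add (hq.mul_right h) (hr.mul_left (aeval z q)) using 1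
  rw [map_mul]
  ring

lemma neg (hg : HasExpansion z g a b) : HasExpansion z (-g) (-a) (-b) :=
  ((const z (-1)).mul hg).congr (by simp) (by simp) (by simp)

lemma sub (hg : HasExpansion z g a b) (hh : HasExpansion z h c d) :
    HasExpansion z (g - h) (a - c) (b - d) :=
  (hg.add hh.neg).congr (by ring) (by ring) (by ring)

lemma pow (hg : HasExpansion z g a b) (n : ℕ) :
    HasExpansion z (g ^ (n + 1)) (a ^ (n + 1)) ((n + 1) * a ^ n * b) := by
  induction n with
  | zero => exact hg.congr (by simp) (by simp) (by simp)
  | succ n ih => exact (hg.mul ih).congr (by ring) (by ring) (by push_cast; ring)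

lemma dvd (hg : HasExpansion z g 0 b) : z ∣ g := by
  obtain ⟨q, hq0, -, hq⟩ := hg 1
  obtain ⟨r, rfl⟩ := X_dvd_iff.mpr hq0
  rw [pow_one, map_mul, aeval_X] at hq
  exact (dvd_sub_left (dvd_mul_right z _)).mp hq

/-- The inverse of an element with constant coefficient `1`. -/
lemma inv (hg : HasExpansion z g 1 b) (hgh : g * h = 1) : HasExpansion z h 1 (-b) := fun N ↦ by
  -- The inverse is approximated by a truncated geometric series in `1 - q`, a multiple of `X`. The
  -- extra 2 keeps the two lowest coefficients correct even for `N = 0`.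
  obtain ⟨q, hq0, hq1, hq⟩ := hg (N + 2)
  have hX : (X : A[X]) ∣ 1 - q := X_dvd_iff.mpr (by simp [hq0])
  have hX2 : (X : A[X]) ^ 2 ∣ 1 - q * ∑ i ∈ Finset.range (N + 2), (1 - q) ^ i := by
    have h1 := mul_neg_geom_sum (1 - q) (N + 2)
    rw [sub_sub_cancel] at h1
    rw [h1, sub_sub_cancel]
    exact (pow_dvd_pow X (by omega)).trans (pow_dvd_pow_of_dvd hX _)
  have h1 := mul_neg_geom_sum (1 - q) (N + 2)
  rw [sub_sub_cancel] at h1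
  set s := ∑ i ∈ Finset.range (N + 2), (1 - q) ^ i
  have hc0 := X_pow_dvd_iff.mp hX2 0 (by omega)
  have hc1 := X_pow_dvd_iff.mp hX2 1 (by omega)
  simp only [coeff_sub, coeff_one, mul_coeff_zero, mul_coeff_one, hq0, hq1] at hc0 hc1
  have hs0 : s.coeff 0 = 1 := by
    simp at hc0
    linear_combination -hc0
  refine ⟨s, hs0, ?_, ?_⟩
  · rw [hs0] at hc1
    simp at hc1
    linear_combination -hc1
  · have h2 : z ^ N ∣ aeval z ((1 - q) ^ (N + 2)) := by
      obtain ⟨r, hr⟩ := hX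
      rw [hr, mul_pow, map_mul, map_pow, aeval_X]
      exact (pow_dvd_pow z (by omega)).trans (dvd_mul_right _ _)
    have h3 : h - aeval z s =
        h * (aeval z ((1 - q) ^ (N + 2)) - (g - aeval z q) * aeval z s) := by
      have h4 := congrArg (aeval z) h1
      simp only [map_sub, map_mul, map_one] at h4
      linear_combination (aeval z s - h * 0) * hgh - h * h4
    rw [h3]
    exact (dvd_sub h2 (((pow_dvd_pow z (by omega)).trans hq).mul_right _)).mul_left _

/-- Such a `g` is `1 + z * r` with `z` in the Jacobson radical. -/
lemma isUnit (hz : z ∈ Ideal.jacobson (⊥ : Ideal B)) (hg : HasExpansion z g 1 b) : IsUnit g := by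
  have h1 : HasExpansion z (g - 1) 0 b := (hg.sub (one z)).congr rfl (by ring) (by ring)
  obtain ⟨r, hr⟩ := h1.dvd
  have := Ideal.mem_jacobson_bot.mp hz r
  rwa [← hr, sub_add_cancel] at this

end HasExpansion

/-! ### Coordinates at infinity and negation -/

namespace WeierstrassCurve

section Ring

variable {R S : Type*} [CommRing R] [CommRing S] (W : WeierstrassCurve R)

/-- The Weierstrass equation at infinity, in the coordinates `z = -x / y` and `w = -1 / y`. -/
def EquationAtInfinity (z w : R) : Prop :=
  w = z ^ 3 + W.a₁ * z * w + W.a₂ * z ^ 2 * w + W.a₃ * w ^ 2 + W.a₄ * z * w ^ 2 + W.a₆ * w ^ 3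

/-- The numerator of the slope of a chord or a tangent in the coordinates at infinity. -/
def slopeNum (z₁ w₁ z₂ : R) : R :=
  z₁ ^ 2 + z₁ * z₂ + z₂ ^ 2 + W.a₁ * w₁ + W.a₂ * (z₁ + z₂) * w₁ + W.a₄ * w₁ ^ 2

/-- The denominator of the slope of a chord or a tangent in the coordinates at infinity. -/
def slopeDen (w₁ z₂ w₂ : R) : R :=
  1 - W.a₁ * z₂ - W.a₂ * z₂ ^ 2 - W.a₃ * (w₁ + w₂) - W.a₄ * z₂ * (w₁ + w₂) -
    W.a₆ * (w₁ ^ 2 + w₁ * w₂ + w₂ ^ 2)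

/-- The leading coefficient of the equation of the curve on the line `w = m z + n`. -/
def lineLead (m : R) : R :=
  1 + W.a₂ * m + W.a₄ * m ^ 2 + W.a₆ * m ^ 3

/-- The next coefficient of the equation of the curve on the line `w = m z + n`. -/
def lineNext (m n : R) : R :=
  W.a₁ * m + W.a₂ * n + W.a₃ * m ^ 2 + 2 * W.a₄ * m * n + 3 * W.a₆ * m ^ 2 * n

/-- The denominator of the negation map in the coordinates at infinity. -/
def negDen (z w : R) : R :=
  1 - W.a₁ * z - W.a₃ * w

lemma map_slopeNum (f : R →+* S) (z₁ w₁ z₂ : R) :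
    f (W.slopeNum z₁ w₁ z₂) = (W.map f).slopeNum (f z₁) (f w₁) (f z₂) := by
  simp [slopeNum]

lemma map_slopeDen (f : R →+* S) (w₁ z₂ w₂ : R) :
    f (W.slopeDen w₁ z₂ w₂) = (W.map f).slopeDen (f w₁) (f z₂) (f w₂) := by
  simp [slopeDen]

lemma map_lineLead (f : R →+* S) (m : R) : f (W.lineLead m) = (W.map f).lineLead (f m) := by
  simp [lineLead]

lemma map_lineNext (f : R →+* S) (m n : R) :
    f (W.lineNext m n) = (W.map f).lineNext (f m) (f n) := by
  simp only [lineNext, map_add, map_mul, map_pow, map_ofNat, map_a₁, map_a₂, map_a₃, map_a₄, map_a₆]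

lemma map_negDen (f : R →+* S) (z w : R) : f (W.negDen z w) = (W.map f).negDen (f z) (f w) := by
  simp [negDen]

end Ring

section Field

variable {F : Type*} [Field F] (W : WeierstrassCurve F)

/-- `(z, w)` are the coordinates at infinity of the affine point `P`. -/
def IsCoordAtInfinity (z w : F) : W.toAffine.Point → Prop
  | .zero => False
  | .some x y _ => w * y = -1 ∧ z = x * w

variable {W}

lemma IsCoordAtInfinity.w_ne_zero {z w : F} {P : W.toAffine.Point}
    (h : W.IsCoordAtInfinity z w P) : w ≠ 0 := by
  rcases P with _ | ⟨x, y, hP⟩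
  · exact h.elim
  · rintro rfl
    simpa using h.1

lemma IsCoordAtInfinity.unique_left {z w z' w' : F} {P : W.toAffine.Point}
    (h : W.IsCoordAtInfinity z w P) (h' : W.IsCoordAtInfinity z' w' P) : z = z' ∧ w = w' := by
  rcases P with _ | ⟨x, y, hP⟩
  · exact h.elim
  have hy : y ≠ 0 := by
    rintro rfl
    simpa using h.1
  have hw : w = w' := mul_right_cancel₀ hy (h.1.trans h'.1.symm)
  exact ⟨by rw [h.2, h'.2, hw], hw⟩

lemma IsCoordAtInfinity.equation {z w : F} {P : W.toAffine.Point}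
    (h : W.IsCoordAtInfinity z w P) : W.EquationAtInfinity z w := by
  rcases P with _ | ⟨x, y, hP⟩
  · exact h.elim
  obtain ⟨h1, rfl⟩ := h
  have h2 := (Affine.equation_iff ..).mp hP.1
  rw [EquationAtInfinity]
  have e : w ^ 2 * y ^ 2 = 1 := by linear_combination (w * y - 1) * h1
  linear_combination w ^ 3 * h2 - w * e - (W.a₁ * x * w ^ 2 + W.a₃ * w ^ 2) * h1

lemma IsCoordAtInfinity.neg {z w e : F} {P : W.toAffine.Point}
    (h : W.IsCoordAtInfinity z w P) (he : W.negDen z w * e = 1) :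
    W.IsCoordAtInfinity (-(z * e)) (-(w * e)) (-P) := by
  rcases P with _ | ⟨x, y, hP⟩
  · exact h.elim
  obtain ⟨h1, rfl⟩ := h
  rw [Affine.Point.neg_some]
  rw [negDen] at he
  refine ⟨?_, by ring⟩
  rw [Affine.negY]
  linear_combination -he + e * h1

end Field

end WeierstrassCurve

/-! ### Chords and tangents in the coordinates at infinity -/

namespace WeierstrassCurve

section Field

variable {F : Type*} [Field F] [DecidableEq F] {W : WeierstrassCurve F}

/-- Subtracting the two equations and grouping terms gives a slope whose denominator is 1 plus terms
vanishing at infinity. It stays meaningful when the points coincide, where it gives the tangent. -/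
lemma sub_mul_slopeDen {R : Type*} [CommRing R] {W : WeierstrassCurve R} {z₁ w₁ z₂ w₂ : R}
    (h₁ : W.EquationAtInfinity z₁ w₁) (h₂ : W.EquationAtInfinity z₂ w₂) :
    (w₂ - w₁) * W.slopeDen w₁ z₂ w₂ = (z₂ - z₁) * W.slopeNum z₁ w₁ z₂ := by
  rw [EquationAtInfinity] at h₁ h₂
  rw [slopeDen, slopeNum]
  linear_combination h₂ - h₁

/-- The chord or tangent through two points, in affine coordinates and in those at infinity. -/
lemma line_eq {x₁ y₁ x₂ y₂ w₁ w₂ m : F} (h₁ : W.toAffine.Nonsingular x₁ y₁)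
    (h₂ : W.toAffine.Nonsingular x₂ y₂) (hxy : ¬(x₁ = x₂ ∧ y₁ = W.toAffine.negY x₂ y₂))
    (hw₁ : w₁ * y₁ = -1) (hw₂ : w₂ * y₂ = -1)
    (hD : W.slopeDen w₁ (x₂ * w₂) w₂ ≠ 0)
    (hm : W.slopeDen w₁ (x₂ * w₂) w₂ * m = W.slopeNum (x₁ * w₁) w₁ (x₂ * w₂)) :
    (w₁ - m * (x₁ * w₁)) * W.toAffine.slope x₁ x₂ y₁ y₂ = m ∧
      w₂ = m * (x₂ * w₂) + (w₁ - m * (x₁ * w₁)) := by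
  have hw₁0 : w₁ ≠ 0 := by rintro rfl; simp at hw₁
  have hw₂0 : w₂ ≠ 0 := by rintro rfl; simp at hw₂
  have E₁ : W.EquationAtInfinity (x₁ * w₁) w₁ :=
    IsCoordAtInfinity.equation (P := .some _ _ h₁) ⟨hw₁, rfl⟩
  have E₂ : W.EquationAtInfinity (x₂ * w₂) w₂ :=
    IsCoordAtInfinity.equation (P := .some _ _ h₂) ⟨hw₂, rfl⟩
  by_cases hx : x₁ = x₂
  · have hy : y₁ ≠ W.toAffine.negY x₂ y₂ := fun h ↦ hxy ⟨hx, h⟩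
    have hy' : y₁ = y₂ := Affine.Y_eq_of_Y_ne h₁.1 h₂.1 hx hy
    subst hx hy'
    have hw : w₁ = w₂ := by
      have hy0 : y₁ ≠ 0 := by rintro rfl; simp at hw₁
      exact mul_right_cancel₀ hy0 (hw₁.trans hw₂.symm)
    subst hw
    refine ⟨?_, by ring⟩
    rw [Affine.slope_of_Y_ne rfl hy]
    have hd : y₁ - W.toAffine.negY x₁ y₁ ≠ 0 := sub_ne_zero.mpr hy
    rw [mul_div_assoc', div_eq_iff hd]
    rw [EquationAtInfinity] at E₁
    rw [slopeDen, slopeNum] at hm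
    apply mul_left_cancel₀ (pow_ne_zero 2 hw₁0)
    rw [Affine.negY]
    linear_combination -w₁ * hm + (-W.a₁ * w₁ ^ 2 - 2 * m * w₁ + W.a₁ * m * x₁ * w₁ ^ 2) * hw₁ +
      3 * m * E₁
  · have hm' : m * (x₂ * w₂ - x₁ * w₁) = w₂ - w₁ := by
      apply mul_left_cancel₀ hD
      linear_combination (x₂ * w₂ - x₁ * w₁) * hm - sub_mul_slopeDen E₁ E₂
    refine ⟨?_, by linear_combination -hm'⟩
    rw [Affine.slope_of_X_ne hx, mul_div_assoc', div_eq_iff (sub_ne_zero.mpr hx)]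
    apply mul_left_cancel₀ hw₂0
    linear_combination (w₂ - m * x₁ * w₂) * hw₁ + (-w₁ + m * x₁ * w₁) * hw₂ + hm'

/-- The third point of the curve on a chord or tangent, in the coordinates at infinity. -/
lemma third_point {x₁ y₁ x₂ y₂ w₁ w₂ m k : F} (h₁ : W.toAffine.Nonsingular x₁ y₁)
    (h₂ : W.toAffine.Nonsingular x₂ y₂) (hxy : ¬(x₁ = x₂ ∧ y₁ = W.toAffine.negY x₂ y₂))
    (hw₁ : w₁ * y₁ = -1) (hw₂ : w₂ * y₂ = -1)
    (hD : W.slopeDen w₁ (x₂ * w₂) w₂ ≠ 0)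
    (hm : W.slopeDen w₁ (x₂ * w₂) w₂ * m = W.slopeNum (x₁ * w₁) w₁ (x₂ * w₂))
    {n z₃ w₃ : F} (hn : n = w₁ - m * (x₁ * w₁))
    (hk : W.lineLead m * k = 1) (hz₃ : z₃ = -(x₁ * w₁) - x₂ * w₂ - W.lineNext m n * k)
    (hw₃ : w₃ = m * z₃ + n) :
    W.IsCoordAtInfinity z₃ w₃ (.some _ _ (Affine.nonsingular_negAdd h₁ h₂ hxy)) := by
  obtain ⟨hl, hw₂'⟩ := line_eq h₁ h₂ hxy hw₁ hw₂ hD hm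
  have hpoly := Affine.addPolynomial_slope h₁.1 h₂.1 hxy
  rw [Affine.addPolynomial_eq, neg_inj, Cubic.prod_X_sub_C_eq, Cubic.toPoly_injective,
    Cubic.mk.injEq] at hpoly
  rw [← hn] at hl hw₂'
  obtain ⟨-, e₁, e₂, e₃⟩ := hpoly
  change w₃ * W.toAffine.negAddY x₁ x₂ y₁ (W.toAffine.slope x₁ x₂ y₁ y₂) = -1 ∧
    z₃ = W.toAffine.addX x₁ x₂ (W.toAffine.slope x₁ x₂ y₁ y₂) * w₃
  rw [Affine.negAddY]
  set l := W.toAffine.slope x₁ x₂ y₁ y₂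
  set x₃ := W.toAffine.addX x₁ x₂ l
  -- The line `w = m z + n` is `y = l x - 1 / n` in affine coordinates.
  have hμ : n * (y₁ - l * x₁) = -1 := by
    rw [mul_sub, ← mul_assoc, hl, hn]
    linear_combination (1 - m * x₁) * hw₁
  have hn0 : n ≠ 0 := by rintro rfl; simp at hμ
  have hw₁0 : w₁ ≠ 0 := by rintro rfl; simp at hw₁
  have hw₂0 : w₂ ≠ 0 := by rintro rfl; simp at hw₂
  have hy₁ : y₁ = l * x₁ - 1 / n := by
    field_simp
    linear_combination hμ
  have hl' : l = m / n := by
    field_simp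
    linear_combination hl
  -- On the line, the equation of the curve becomes the product of the factors `(1 - m xᵢ) z - n
  -- xᵢ`. `hA` and `hB` are its two leading coefficients, and their quotient gives the sum of the
  -- roots `zᵢ`.
  have hA : W.lineLead m = (1 - m * x₁) * (1 - m * x₂) * (1 - m * x₃) := by
    have : (1 - m * x₁) * (1 - m * x₂) * (1 - m * x₃) = 1 + m * (-(x₁ + x₂ + x₃)) +
        m ^ 2 * (x₁ * x₂ + x₁ * x₃ + x₂ * x₃) + m ^ 3 * (-(x₁ * x₂ * x₃)) := by ring
    rw [this, ← e₁, ← e₂, ← e₃, lineLead, hy₁, hl']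
    field_simp
    ring
  have hB : W.lineNext m n = -n * (x₁ * (1 - m * x₂) * (1 - m * x₃) +
      x₂ * (1 - m * x₁) * (1 - m * x₃) + x₃ * (1 - m * x₁) * (1 - m * x₂)) := by
    have : -n * (x₁ * (1 - m * x₂) * (1 - m * x₃) + x₂ * (1 - m * x₁) * (1 - m * x₃) +
        x₃ * (1 - m * x₁) * (1 - m * x₂)) = n * (-(x₁ + x₂ + x₃)) +
        2 * m * n * (x₁ * x₂ + x₁ * x₃ + x₂ * x₃) + 3 * m ^ 2 * n * (-(x₁ * x₂ * x₃)) := by ring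
    rw [this, ← e₁, ← e₂, ← e₃, lineNext, hy₁, hl']
    field_simp
    ring
  have hu₁ : w₁ * (1 - m * x₁) = n := by rw [hn]; ring
  have hu₂ : w₂ * (1 - m * x₂) = n := by linear_combination hw₂'
  have hu₁0 : 1 - m * x₁ ≠ 0 := right_ne_zero_of_mul (hu₁ ▸ hn0)
  have hu₂0 : 1 - m * x₂ ≠ 0 := right_ne_zero_of_mul (hu₂ ▸ hn0)
  have key : (1 - m * x₃) * z₃ = n * x₃ := by
    apply mul_left_cancel₀ (mul_ne_zero hu₁0 hu₂0)
    rw [hA] at hk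
    rw [hz₃, hB]
    linear_combination (n * (x₁ * (1 - m * x₂) * (1 - m * x₃) +
      x₂ * (1 - m * x₁) * (1 - m * x₃) + x₃ * (1 - m * x₁) * (1 - m * x₂))) * hk -
      (x₁ * (1 - m * x₂) * (1 - m * x₃)) * hu₁ - (x₂ * (1 - m * x₁) * (1 - m * x₃)) * hu₂
  constructor
  · apply mul_left_cancel₀ hn0
    rw [hw₃]
    linear_combination (m * z₃ + n) * (hμ + x₃ * hl) - m * key
  · rw [hw₃]
    linear_combination key

lemma IsCoordAtInfinity.add {P Q : W.toAffine.Point} {z₁ w₁ z₂ w₂ : F}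
    (hP : W.IsCoordAtInfinity z₁ w₁ P) (hQ : W.IsCoordAtInfinity z₂ w₂ Q) (hPQ : P + Q ≠ 0)
    {m k n z₃ w₃ e : F} (hD : W.slopeDen w₁ z₂ w₂ ≠ 0)
    (hm : W.slopeDen w₁ z₂ w₂ * m = W.slopeNum z₁ w₁ z₂) (hn : n = w₁ - m * z₁)
    (hk : W.lineLead m * k = 1) (hz₃ : z₃ = -z₁ - z₂ - W.lineNext m n * k)
    (hw₃ : w₃ = m * z₃ + n) (he : W.negDen z₃ w₃ * e = 1) :
    W.IsCoordAtInfinity (-(z₃ * e)) (-(w₃ * e)) (P + Q) := by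
  rcases P with _ | ⟨x₁, y₁, h₁⟩
  · exact hP.elim
  rcases Q with _ | ⟨x₂, y₂, h₂⟩
  · exact hQ.elim
  obtain ⟨hw₁, rfl⟩ := hP
  obtain ⟨hw₂, rfl⟩ := hQ
  have hxy : ¬(x₁ = x₂ ∧ y₁ = W.toAffine.negY x₂ y₂) :=
    fun h ↦ hPQ (Affine.Point.add_of_Y_eq h.1 h.2)
  rw [Affine.Point.add_some hxy]
  exact (third_point h₁ h₂ hxy hw₁ hw₂ hD hm hn hk hz₃ hw₃).neg he

end Field

end WeierstrassCurve

/-! ### Expansions of the group law -/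

namespace WeierstrassCurve

section Expansion

variable {A B : Type*} [CommRing A] [CommRing B] [Algebra A B] {W : WeierstrassCurve A}

/-- The equation exhibits `w` as a fixed point of a polynomial map that contracts `z`-adically;
iterating it from `0` gives the approximations. -/
lemma EquationAtInfinity.hasExpansion {z w : B}
    (h : (W.map (algebraMap A B)).EquationAtInfinity z w)
    (hz : z ∈ Ideal.jacobson (⊥ : Ideal B)) (hw : w ∈ Ideal.jacobson (⊥ : Ideal B)) :
    HasExpansion z w (0 : A) 0 := by
  rw [EquationAtInfinity] at h
  set V := W.map (algebraMap A B)
  have hzw : z ∣ w := by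
    -- Collecting the multiples of `w` turns the equation into `w * unit = z ^ 3`.
    have hu := Ideal.mem_jacobson_bot.mp (Ideal.add_mem _
      (Ideal.mul_mem_left _ (-(V.a₁ + V.a₂ * z)) hz)
      (Ideal.mul_mem_left _ (-(V.a₃ + V.a₄ * z + V.a₆ * w)) hw)) 1
    refine hu.dvd_mul_right.mp (Dvd.intro (z ^ 2) ?_)
    linear_combination -h
  have key (N : ℕ) : ∃ q : A[X], X ^ 2 ∣ q ∧ z ^ N ∣ w - aeval z q := by
    induction N with
    | zero => exact ⟨0, by simp, by simp⟩
    | succ N ih =>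
      obtain ⟨q, hq, hN⟩ := ih
      refine ⟨X ^ 3 + C W.a₁ * X * q + C W.a₂ * X ^ 2 * q + C W.a₃ * q ^ 2 + C W.a₄ * X * q ^ 2 +
        C W.a₆ * q ^ 3, ?_, ?_⟩
      · refine dvd_add (dvd_add (dvd_add (dvd_add (dvd_add (pow_dvd_pow X (by omega)) ?_) ?_) ?_)
          ?_) ?_
        · exact hq.mul_left _
        · exact hq.mul_left _
        · exact (hq.trans (dvd_pow_self q (by omega))).mul_left _
        · exact (hq.trans (dvd_pow_self q (by omega))).mul_left _
        · exact (hq.trans (dvd_pow_self q (by omega))).mul_left _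
      · have hzq : z ∣ aeval z q := by
          obtain ⟨r, rfl⟩ := hq
          rw [map_mul, map_pow, aeval_X]
          exact (dvd_pow_self z (by omega)).trans (dvd_mul_right _ _)
        set t := aeval z q with ht
        -- This is the difference quotient of the right-hand side between `w` and `t`, so each
        -- iteration gains a factor `z`.
        have hs : z ∣ z * (V.a₁ + V.a₂ * z + V.a₄ * (w + t)) + w * (V.a₃ + V.a₆ * (w + t)) +
            t * (V.a₃ + V.a₆ * t) :=
          dvd_add (dvd_add (dvd_mul_right _ _) (hzw.mul_right _)) (hzq.mul_right _)
        rw [pow_succ]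
        convert mul_dvd_mul hN hs using 1
        simp only [map_add, map_mul, map_pow, aeval_X, aeval_C, ← ht]
        change w - (z ^ 3 + V.a₁ * z * t + V.a₂ * z ^ 2 * t + V.a₃ * t ^ 2 + V.a₄ * z * t ^ 2 +
          V.a₆ * t ^ 3) = _
        linear_combination h
  intro N
  obtain ⟨q, hq, hN⟩ := key N
  exact ⟨q, X_pow_dvd_iff.mp hq 0 (by omega), X_pow_dvd_iff.mp hq 1 (by omega), hN⟩

lemma hasExpansion_slopeNum {z z₁ w₁ z₂ : B} {b c : A} (hz₁ : HasExpansion z z₁ 0 b)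
    (hw₁ : HasExpansion z w₁ (0 : A) 0) (hz₂ : HasExpansion z z₂ 0 c) :
    HasExpansion z ((W.map (algebraMap A B)).slopeNum z₁ w₁ z₂) (0 : A) 0 :=
  ((((((hz₁.pow 1).add (hz₁.mul hz₂)).add (hz₂.pow 1)).add
    ((HasExpansion.const z W.a₁).mul hw₁)).add
    (((HasExpansion.const z W.a₂).mul (hz₁.add hz₂)).mul hw₁)).add
    ((HasExpansion.const z W.a₄).mul (hw₁.pow 1))).congr rfl (by simp) (by simp)

lemma hasExpansion_slopeDen {z w₁ z₂ w₂ : B} {c : A}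
    (hw₁ : HasExpansion z w₁ (0 : A) 0) (hz₂ : HasExpansion z z₂ 0 c)
    (hw₂ : HasExpansion z w₂ (0 : A) 0) :
    HasExpansion z ((W.map (algebraMap A B)).slopeDen w₁ z₂ w₂) (1 : A) (-(W.a₁ * c)) :=
  ((((((HasExpansion.one z).sub ((HasExpansion.const z W.a₁).mul hz₂)).sub
    ((HasExpansion.const z W.a₂).mul (hz₂.pow 1))).sub
    ((HasExpansion.const z W.a₃).mul (hw₁.add hw₂))).sub
    (((HasExpansion.const z W.a₄).mul hz₂).mul (hw₁.add hw₂))).sub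
    ((HasExpansion.const z W.a₆).mul
      (((hw₁.pow 1).add (hw₁.mul hw₂)).add (hw₂.pow 1)))).congr rfl (by simp) (by simp)

lemma hasExpansion_lineLead {z m : B} (hm : HasExpansion z m (0 : A) 0) :
    HasExpansion z ((W.map (algebraMap A B)).lineLead m) (1 : A) 0 :=
  ((((HasExpansion.one z).add ((HasExpansion.const z W.a₂).mul hm)).add
    ((HasExpansion.const z W.a₄).mul (hm.pow 1))).add
    ((HasExpansion.const z W.a₆).mul (hm.pow 2))).congr rfl (by simp) (by simp)

lemma hasExpansion_lineNext {z m n : B} (hm : HasExpansion z m (0 : A) 0)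
    (hn : HasExpansion z n (0 : A) 0) :
    HasExpansion z ((W.map (algebraMap A B)).lineNext m n) (0 : A) 0 :=
  ((((((HasExpansion.const z W.a₁).mul hm).add ((HasExpansion.const z W.a₂).mul hn)).add
    ((HasExpansion.const z W.a₃).mul (hm.pow 1))).add
    ((((HasExpansion.const z 2).mul (HasExpansion.const z W.a₄)).mul hm).mul hn)).add
    ((((HasExpansion.const z 3).mul (HasExpansion.const z W.a₆)).mul (hm.pow 1)).mul hn)).congr
    (by simp only [lineNext, map_ofNat, map_a₁, map_a₂, map_a₃, map_a₄, map_a₆]) (by simp)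
    (by simp)

lemma hasExpansion_negDen {z z₁ w₁ : B} {b : A} (hz₁ : HasExpansion z z₁ 0 b)
    (hw₁ : HasExpansion z w₁ (0 : A) 0) :
    HasExpansion z ((W.map (algebraMap A B)).negDen z₁ w₁) (1 : A) (-(W.a₁ * b)) :=
  (((HasExpansion.one z).sub ((HasExpansion.const z W.a₁).mul hz₁)).sub
    ((HasExpansion.const z W.a₃).mul hw₁)).congr rfl (by simp) (by simp)

variable {L ι : Type*} [Field L] [DecidableEq L] [Algebra A L] (φ : ι → B →ₐ[A] L)
  {P Q : ι → (W.map (algebraMap A L)).toAffine.Point}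

omit [DecidableEq L] in
lemma map_map_algHom (f : B →ₐ[A] L) :
    (W.map (algebraMap A B)).map (f : B →+* L) = W.map (algebraMap A L) := by
  rw [map_map]
  congr 1
  exact f.comp_algebraMap

/-- The coordinates at infinity of a sum of points have expansions if those of the points do. -/
lemma exists_hasExpansion_add {z z₁ w₁ z₂ w₂ : B} {b c : A}
    (hz : z ∈ Ideal.jacobson (⊥ : Ideal B)) (hz₁ : HasExpansion z z₁ 0 b)
    (hw₁ : HasExpansion z w₁ (0 : A) 0) (hz₂ : HasExpansion z z₂ 0 c)
    (hw₂ : HasExpansion z w₂ (0 : A) 0)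
    (hP : ∀ i, (W.map (algebraMap A L)).IsCoordAtInfinity (φ i z₁) (φ i w₁) (P i))
    (hQ : ∀ i, (W.map (algebraMap A L)).IsCoordAtInfinity (φ i z₂) (φ i w₂) (Q i))
    (hPQ : ∀ i, P i + Q i ≠ 0) :
    ∃ z₃ w₃ : B, HasExpansion z z₃ 0 (b + c) ∧ HasExpansion z w₃ (0 : A) 0 ∧
      ∀ i, (W.map (algebraMap A L)).IsCoordAtInfinity (φ i z₃) (φ i w₃) (P i + Q i) := by
  set V := W.map (algebraMap A B)
  have hD := hasExpansion_slopeDen (W := W) hw₁ hz₂ hw₂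
  -- The three denominators have constant coefficient 1. The slope and the intercept have no terms
  -- of degree below 2, so the linear part of the sum is just `b + c`.
  obtain ⟨d, hd⟩ := (hD.isUnit hz).exists_right_inv
  set m := V.slopeNum z₁ w₁ z₂ * d with hm_def
  have hm : HasExpansion z m (0 : A) 0 :=
    ((hasExpansion_slopeNum hz₁ hw₁ hz₂).mul (hD.inv hd)).congr rfl (by simp) (by simp)
  set n := w₁ - m * z₁ with hn_def
  have hn : HasExpansion z n (0 : A) 0 := (hw₁.sub (hm.mul hz₁)).congr rfl (by simp) (by simp)
  have hA := hasExpansion_lineLead (W := W) hm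
  obtain ⟨k, hk⟩ := (hA.isUnit hz).exists_right_inv
  set z₃ := -z₁ - z₂ - V.lineNext m n * k with hz₃_def
  have hz₃ : HasExpansion z z₃ 0 (-(b + c)) :=
    ((hz₁.neg.sub hz₂).sub ((hasExpansion_lineNext hm hn).mul (hA.inv hk))).congr rfl (by simp)
      (by ring)
  set w₃ := m * z₃ + n with hw₃_def
  have hw₃ : HasExpansion z w₃ (0 : A) 0 := ((hm.mul hz₃).add hn).congr rfl (by simp) (by simp)
  have hE := hasExpansion_negDen (W := W) hz₃ hw₃
  obtain ⟨e, he⟩ := (hE.isUnit hz).exists_right_inv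
  refine ⟨-(z₃ * e), -(w₃ * e), (hz₃.mul (hE.inv he)).neg.congr rfl (by simp) (by simp),
    (hw₃.mul (hE.inv he)).neg.congr rfl (by simp) (by simp), fun i ↦ ?_⟩
  have hV : V.map (φ i : B →+* L) = W.map (algebraMap A L) := map_map_algHom (φ i)
  have hd' := congrArg (φ i : B →+* L) hd
  have hk' := congrArg (φ i : B →+* L) hk
  have he' := congrArg (φ i : B →+* L) he
  have hm' := congrArg (φ i : B →+* L) hm_def
  have hz₃' := congrArg (φ i : B →+* L) hz₃_def
  simp only [map_mul, map_sub, map_neg, map_one] at hd' hk' he' hm' hz₃'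
  rw [map_slopeDen, hV] at hd'
  rw [map_lineLead, hV] at hk'
  rw [map_negDen, hV] at he'
  rw [map_slopeNum, hV] at hm'
  rw [map_lineNext, hV] at hz₃'
  simp only [RingHom.coe_coe] at hd' hk' he' hm' hz₃'
  have := (hP i).add (hQ i) (hPQ i) (left_ne_zero_of_mul_eq_one hd')
    (m := φ i m) (k := φ i k) (n := φ i n) (z₃ := φ i z₃) (w₃ := φ i w₃) (e := φ i e)
    (by
      refine (congrArg _ hm').trans ?_
      linear_combination (W.map (algebraMap A L)).slopeNum (φ i z₁) (φ i w₁) (φ i z₂) * hd')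
    (by simp [hn_def]) hk' hz₃' (by simp [hw₃_def]) he'
  simpa using this

lemma exists_hasExpansion_nsmul {z w : B} (hz : z ∈ Ideal.jacobson (⊥ : Ideal B))
    (hw : HasExpansion z w (0 : A) 0)
    (hP : ∀ i, (W.map (algebraMap A L)).IsCoordAtInfinity (φ i z) (φ i w) (P i)) (n : ℕ)
    (hn : ∀ k ≤ n, ∀ i, (k + 1) • P i ≠ 0) :
    ∃ z' w' : B, HasExpansion z z' 0 (n + 1 : A) ∧ HasExpansion z w' (0 : A) 0 ∧
      ∀ i, (W.map (algebraMap A L)).IsCoordAtInfinity (φ i z') (φ i w') ((n + 1) • P i) := by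
  induction n with
  | zero => exact ⟨z, w, (HasExpansion.self z).congr rfl rfl (by simp), hw, by simpa using hP⟩
  | succ n ih =>
    obtain ⟨z', w', hz', hw', hc⟩ := ih fun k hk ↦ hn k (by omega)
    obtain ⟨z₃, w₃, hz₃, hw₃, hc₃⟩ := exists_hasExpansion_add φ hz hz' hw' (HasExpansion.self z) hw
      hc hP fun i ↦ by simpa only [← succ_nsmul] using hn (n + 1) le_rfl i
    exact ⟨z₃, w₃, hz₃.congr rfl rfl (by push_cast; ring), hw₃,
      fun i ↦ by simpa only [← succ_nsmul] using hc₃ i⟩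

/-- A relation between the parameters of the points of exact order `p`. -/
lemma hasExpansion_zero_of_order (hφ : ∀ b c : B, (∀ i, φ i b = φ i c) → b = c) {z w : B}
    (hz : z ∈ Ideal.jacobson (⊥ : Ideal B)) (hw : HasExpansion z w (0 : A) 0)
    (hP : ∀ i, (W.map (algebraMap A L)).IsCoordAtInfinity (φ i z) (φ i w) (P i)) {p : ℕ}
    (hp : 2 ≤ p) (hPp : ∀ i, addOrderOf (P i) = p) : HasExpansion z (0 : B) (0 : A) p := by
  obtain ⟨n, rfl⟩ := Nat.exists_eq_add_of_le' hp
  obtain ⟨z', w', hz', -, hc⟩ := exists_hasExpansion_nsmul φ hz hw hP n fun k hk i h ↦ by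
    have := Nat.le_of_dvd (by omega) ((hPp i) ▸ addOrderOf_dvd_of_nsmul_eq_zero h)
    omega
  have hE := hasExpansion_negDen (W := W) (HasExpansion.self (A := A) z) hw
  obtain ⟨e, he⟩ := (hE.isUnit hz).exists_right_inv
  -- The point `p • P = 0` has no affine coordinates, so the relation is read off from `(p - 1) • P
  -- = -P`. The linear coefficients are `p - 1` and `-1`, with difference `p`.
  have hzz : z' = -(z * e) := hφ _ _ fun i ↦ by
    have he' := congrArg (φ i : B →+* L) he
    rw [map_mul, map_negDen, map_map_algHom, map_one] at he'
    have h1 := (hP i).neg he'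
    have h2 : (n + 1) • P i = -P i := by
      rw [eq_neg_iff_add_eq_zero, ← succ_nsmul, ← hPp i, addOrderOf_nsmul_eq_zero]
    have h3 := hc i
    rw [h2] at h3
    simpa using (h3.unique_left h1).1
  refine (hz'.sub ((HasExpansion.self z).mul (hE.inv he)).neg).congr (by rw [hzz, sub_self])
    (by simp) (by push_cast; ring)

end Expansion

end WeierstrassCurve

/-! ### Newton polygons and torsion parameters -/

section Valuation

open NNReal

variable {A L : Type*} [CommRing A] [Field L] [Algebra A L] (v : Valuation L ℝ≥0)

lemma Valuation.map_aeval_of_dominant {q : A[X]} {x : L} {j : ℕ}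
    (hj : v (algebraMap A L (q.coeff j) * x ^ j) ≠ 0)
    (h : ∀ k ≠ j, v (algebraMap A L (q.coeff k) * x ^ k) <
      v (algebraMap A L (q.coeff j) * x ^ j)) :
    v (aeval x q) = v (algebraMap A L (q.coeff j) * x ^ j) := by
  rw [aeval_eq_sum_range' (n := max (q.natDegree + 1) (j + 1)) (by simp),
    ← Finset.add_sum_erase _ _ (a := j) (by simp)]
  simp only [Algebra.smul_def]
  exact v.map_add_eq_of_lt_left (v.map_sum_lt hj fun k hk ↦ h k (Finset.ne_of_mem_erase hk))

variable {v}

/-- The Newton polygon argument for polynomials whose linear coefficient is of least positive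
valuation. -/
lemma Valuation.exists_pow_eq_of_linear_coeff {π : A} (hv : ∀ a : A, v (algebraMap A L a) ≤ 1)
    (hπ : ∀ a : A, v (algebraMap A L a) = 1 ∨ v (algebraMap A L a) ≤ v (algebraMap A L π))
    (hπ0 : v (algebraMap A L π) ≠ 0) {q : A[X]} (hq0 : q.coeff 0 = 0) (hq1 : q.coeff 1 = π) :
    ∃ m, ∀ x : L, v x ≠ 0 → v x < 1 →
      v (aeval x q) < v (algebraMap A L π) * v x → v x ^ (m + 1) = v (algebraMap A L π) := by
  classical
  have hsmall {x : L} (h0 : v x ≠ 0) (h1 : v x < 1) {k : ℕ} (hk : 2 ≤ k)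
      (hc : v (algebraMap A L (q.coeff k)) ≤ v (algebraMap A L π)) :
      v (algebraMap A L (q.coeff k) * x ^ k) < v (algebraMap A L π) * v x := by
    rw [map_mul, map_pow]
    calc _ ≤ v (algebraMap A L π) * v x ^ k := by gcongr
      _ < _ := by
        have : v x ^ k < v x := pow_lt_self_of_lt_one₀ (pos_iff_ne_zero.mpr h0) h1 hk
        exact mul_lt_mul_of_pos_left this (pos_iff_ne_zero.mpr hπ0)
  have hone {x : L} (h0 : v x ≠ 0) : 0 < v (algebraMap A L π) * v x :=
    pos_iff_ne_zero.mpr (mul_ne_zero hπ0 h0)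
  have hdom {x : L} (h0 : v x ≠ 0)
      (hd : ∀ k, 2 ≤ k → v (algebraMap A L (q.coeff k) * x ^ k) < v (algebraMap A L π) * v x) :
      v (aeval x q) = v (algebraMap A L π) * v x := by
    have := v.map_aeval_of_dominant (q := q) (x := x) (j := 1)
    simp only [hq1, pow_one, map_mul] at this
    refine this (hone h0).ne' fun k hk ↦ ?_
    rcases Nat.lt_or_ge k 2 with hk2 | hk2
    · obtain rfl : k = 0 := by omega
      simpa [hq0] using (hone h0)
    · simpa using hd k hk2
  by_cases hex : ∃ m, v (algebraMap A L (q.coeff (m + 2))) = 1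
  -- Let `m + 2` be the first degree from 2 on with a unit coefficient. Unless the terms of degrees
  -- 1 and `m + 2` balance, one of them strictly dominates all others and the value of `q` at `x` is
  -- too large.
  · refine ⟨Nat.find hex, fun x h0 h1 hx ↦ ?_⟩
    have hm := Nat.find_spec hex
    have hlt (k : ℕ) (hk2 : 2 ≤ k) (hk : k < Nat.find hex + 2) :
        v (algebraMap A L (q.coeff k)) ≤ v (algebraMap A L π) := by
      obtain ⟨l, rfl⟩ := Nat.exists_eq_add_of_le' hk2
      exact (hπ _).resolve_left (Nat.find_min hex (by omega))
    set m := Nat.find hex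
    have hx0 : 0 < v x := pos_iff_ne_zero.mpr h0
    have hge (k : ℕ) : v (algebraMap A L (q.coeff k) * x ^ k) ≤ v x ^ k := by
      rw [map_mul, map_pow]
      exact mul_le_of_le_one_left' (hv _)
    rcases lt_trichotomy (v x ^ (m + 1)) (v (algebraMap A L π)) with h | h | h
    · refine absurd (hdom h0 fun k hk ↦ ?_) hx.ne
      rcases Nat.lt_or_ge k (m + 2) with hk2 | hk2
      · exact hsmall h0 h1 hk (hlt k hk hk2)
      · calc _ ≤ v x ^ k := hge k
          _ ≤ v x ^ (m + 2) := pow_le_pow_of_le_one (zero_le) h1.le hk2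
          _ = v x ^ (m + 1) * v x := pow_succ _ _
          _ < _ := mul_lt_mul_of_pos_right h hx0
    · exact h
    · have hm' : v (algebraMap A L (q.coeff (m + 2)) * x ^ (m + 2)) = v x ^ (m + 2) := by
        rw [map_mul, map_pow, hm, one_mul]
      have hlt' : v (algebraMap A L π) * v x < v x ^ (m + 2) := by
        rw [pow_succ _ (m + 1)]
        exact mul_lt_mul_of_pos_right h hx0
      have := v.map_aeval_of_dominant (q := q) (x := x) (j := m + 2)
        (by rw [hm']; exact pow_ne_zero _ h0) fun k hk ↦ by
          rw [hm']
          rcases Nat.lt_or_ge k (m + 2) with hk2 | hk2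
          · match k with
            | 0 => simpa [hq0] using pow_pos hx0 (m + 2)
            | 1 => simpa [hq1] using hlt'
            | k + 2 => exact (hsmall h0 h1 (by omega) (hlt _ (by omega) hk2)).trans hlt'
          · exact (hge k).trans_lt (pow_lt_pow_right_of_lt_one₀ hx0 h1 (by omega))
      rw [this, hm'] at hx
      exact absurd (hx.trans hlt') (lt_irrefl _)
  · push Not at hex
    -- Without a unit coefficient the linear term always dominates, so no such `x` exists and the
    -- exponent is arbitrary.
    refine ⟨0, fun x h0 h1 hx ↦ absurd (hdom h0 fun k hk ↦ hsmall h0 h1 hk ?_) hx.ne⟩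
    obtain ⟨l, rfl⟩ := Nat.exists_eq_add_of_le' hk
    exact (hπ _).resolve_left (hex l)

end Valuation

section Valuation

open NNReal

variable {A L : Type*} [CommRing A] [Field L] [Algebra A L] {v : Valuation L ℝ≥0}

/-- The structure map from `A` to the valuation ring of a valuation that is integral on `A`. -/
@[reducible]
noncomputable def Valuation.algebraValuationSubring (hv : ∀ a : A, v (algebraMap A L a) ≤ 1) :
    Algebra A v.valuationSubring :=
  ((algebraMap A L).codRestrict v.valuationSubring.toSubring hv).toAlgebra

lemma Valuation.mem_jacobson_pi {ι : Type*} {z : ι → v.valuationSubring}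
    (hz : ∀ i, v (z i : L) < 1) : z ∈ Ideal.jacobson (⊥ : Ideal (ι → v.valuationSubring)) := by
  refine Ideal.mem_jacobson_bot.mpr fun y ↦ Pi.isUnit_iff.mpr fun i ↦ ?_
  have h1 : v ((z i : L) * y i) < 1 := by
    rw [map_mul]
    exact (mul_le_of_le_one_right' (y i).2).trans_lt (hz i)
  have h2 : v ((z i : L) * y i + 1) = 1 := by
    rw [v.map_add_eq_of_lt_right (by rwa [map_one]), map_one]
  have h0 : (z i : L) * y i + 1 ≠ 0 := by
    intro h
    simp [h] at h2
  refine IsUnit.of_mul_eq_one ⟨((z i : L) * y i + 1)⁻¹, by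
    rw [Valuation.mem_valuationSubring_iff, map_inv₀, h2, inv_one]⟩ (Subtype.ext ?_)
  exact mul_inv_cancel₀ h0

/-- All points of exact order `p` in the kernel of reduction have parameters of the same valuation
if `p` has the least positive valuation on the ring of coefficients. -/
lemma WeierstrassCurve.valuation_parameter_eq [DecidableEq L] {W : WeierstrassCurve A} {p : ℕ}
    (hp : 2 ≤ p) (hv : ∀ a : A, v (algebraMap A L a) ≤ 1)
    (hvp : ∀ a : A, v (algebraMap A L a) = 1 ∨ v (algebraMap A L a) ≤ v p) (hp0 : v p ≠ 0)
    {ι : Type*} [Finite ι] {P : ι → (W.map (algebraMap A L)).toAffine.Point} {z w : ι → L}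
    (hP : ∀ i, (W.map (algebraMap A L)).IsCoordAtInfinity (z i) (w i) (P i))
    (hPp : ∀ i, addOrderOf (P i) = p) (hz : ∀ i, v (z i) < 1) (hw : ∀ i, v (w i) < 1) (i j : ι) :
    z i ≠ 0 ∧ v (z i) = v (z j) := by
  have := Fintype.ofFinite ι
  let _ : Algebra A v.valuationSubring := v.algebraValuationSubring hv
  have hmap (a : A) : (algebraMap A v.valuationSubring a : L) = algebraMap A L a := rfl
  -- Working in the product yields a single polynomial `q`, hence a single exponent `m`, for all the
  -- points.
  let B := ι → v.valuationSubring
  let φ (i : ι) : B →ₐ[A] L :=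
    { (v.valuationSubring.subtype).comp (Pi.evalRingHom _ i) with
      commutes' := fun a ↦ rfl }
  have hφ (b c : B) (h : ∀ i, φ i b = φ i c) : b = c := funext fun i ↦ Subtype.ext (h i)
  let z' : B := fun i ↦ ⟨z i, (hz i).le⟩
  let w' : B := fun i ↦ ⟨w i, (hw i).le⟩
  have hz' : z' ∈ Ideal.jacobson (⊥ : Ideal B) := v.mem_jacobson_pi hz
  have hw' : w' ∈ Ideal.jacobson (⊥ : Ideal B) := v.mem_jacobson_pi hw
  have hP' (i : ι) : (W.map (algebraMap A L)).IsCoordAtInfinity (φ i z') (φ i w') (P i) := hP i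
  have heq : (W.map (algebraMap A B)).EquationAtInfinity z' w' :=
    hφ _ _ fun i ↦ by
      simpa only [EquationAtInfinity, map_add, map_mul, map_pow, map_a₁, map_a₂, map_a₃, map_a₄,
        map_a₆, AlgHom.commutes] using (hP' i).equation
  have hexp := heq.hasExpansion hz' hw'
  -- Since `z` divides `w`, a zero parameter would force `w i = 0`.
  have hz0 (i : ι) : v (z i) ≠ 0 := by
    rw [ne_eq, map_eq_zero]
    intro h0
    obtain ⟨c, hc⟩ := hexp.dvd
    have := congrArg (φ i) hc
    rw [map_mul] at this
    change w i = z i * _ at this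
    rw [h0, zero_mul] at this
    exact (hP i).w_ne_zero this
  have hzero := hasExpansion_zero_of_order φ hφ hz' hexp hP hp hPp
  have hb (i : ι) : ∃ N, v (z i) ^ N < v p * v (z i) :=
    _root_.exists_pow_lt_of_lt_one (pos_iff_ne_zero.mpr (mul_ne_zero hp0 (hz0 i))) (hz i)
  choose N hN using hb
  -- The sum bounds every `N i`, so this precision suffices at all points.
  obtain ⟨q, hq0, hq1, hq⟩ := hzero (∑ i, N i)
  obtain ⟨m, hm⟩ := Valuation.exists_pow_eq_of_linear_coeff (v := v) (π := (p : A)) hv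
    (by simpa using hvp) (by simpa using hp0) hq0 hq1
  have key (i : ι) : v (z i) ^ (m + 1) = v (algebraMap A L p) := by
    refine hm (z i) (hz0 i) (hz i) ?_
    rw [map_natCast]
    refine lt_of_le_of_lt ?_ (hN i)
    obtain ⟨c, hc⟩ := hq
    have h1 := congrArg (φ i) hc
    rw [map_sub, map_zero, zero_sub, map_mul, map_pow, ← aeval_algHom_apply] at h1
    change -aeval (z i) q = z i ^ _ * (c i : L) at h1
    rw [← v.map_neg, h1, map_mul, map_pow]
    refine (mul_le_of_le_one_right' (c i).2).trans (pow_le_pow_of_le_one (zero_le) (hz i).le ?_)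
    exact Finset.single_le_sum (f := N) (fun _ _ ↦ Nat.zero_le _) (Finset.mem_univ i)
  exact ⟨(v.ne_zero_iff).mp (hz0 i),
    (pow_left_inj₀ (zero_le) (zero_le) (Nat.succ_ne_zero m)).mp ((key i).trans (key j).symm)⟩

end Valuation

/-! ### Completions at unramified primes -/

section

open WithZero NNReal

variable {K : Type*} [Field K] [NumberField K] (𝔭 : HeightOneSpectrum (𝓞 K)) {p : ℕ}

/-- Ramification index 1 says that `𝔭` divides `p` exactly once. -/
lemma exp_neg_one_le_valued_natCast (hp : p.Prime) (h𝔭 : (p : 𝓞 K) ∈ 𝔭.asIdeal)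
    (he : 𝔭.asIdeal.ramificationIdx ℤ = 1) :
    exp (-1 : ℤ) ≤ Valued.v (p : 𝔭.adicCompletion K) := by
  have hmap : (Ideal.span {(p : ℤ)}).map (algebraMap ℤ (𝓞 K)) = Ideal.span {(p : 𝓞 K)} := by
    rw [Ideal.map_span]
    simp
  have hbot : Ideal.span {(p : 𝓞 K)} ≠ ⊥ := by simpa using hp.ne_zero
  have hmax : (Ideal.span {(p : ℤ)}).IsMaximal :=
    PrincipalIdealRing.isMaximal_of_irreducible (Nat.prime_iff_prime_int.mp hp).irreducible
  have hlies : 𝔭.asIdeal.LiesOver (Ideal.span {(p : ℤ)}) :=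
    ⟨hmax.eq_of_le (Ideal.IsPrime.under ℤ 𝔭.asIdeal).ne_top (by
      rw [Ideal.span_singleton_le_iff_mem, Ideal.mem_comap]
      simpa using h𝔭)⟩
  have := 𝔭.isPrime
  rw [Ideal.IsDedekindDomain.ramificationIdx_eq_multiplicity (Ideal.span {(p : ℤ)}) 𝔭.asIdeal
    (by rwa [hmap]), hmap] at he
  have hfin : FiniteMultiplicity 𝔭.asIdeal (Ideal.span {(p : 𝓞 K)}) :=
    FiniteMultiplicity.of_not_isUnit (by simpa [Ideal.isUnit_iff] using this.ne_top) hbot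
  have h1 := (𝔭.exp_le_intValuation_iff_emultiplicity_le (r := (p : 𝓞 K)) (n := 1)).mpr
    (by rw [hfin.emultiplicity_eq_multiplicity, he])
  have h2 := 𝔭.valuedAdicCompletion_eq_valuation (K := K) (p : 𝓞 K)
  rw [HeightOneSpectrum.valuation_of_algebraMap] at h2
  rw [← h2] at h1
  simpa using h1

lemma norm_eq_one_or_le_norm_natCast (hp : p.Prime) (h𝔭 : (p : 𝓞 K) ∈ 𝔭.asIdeal)
    (he : 𝔭.asIdeal.ramificationIdx ℤ = 1) (a : 𝔭.adicCompletionIntegers K) :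
    ‖(a : 𝔭.adicCompletion K)‖ = 1 ∨
      ‖(a : 𝔭.adicCompletion K)‖ ≤ ‖(p : 𝔭.adicCompletion K)‖ := by
  have ha : Valued.v (a : 𝔭.adicCompletion K) ≤ 1 := a.2
  simp only [FinitePlace.norm_def]
  rcases ha.eq_or_lt with h | h
  · left
    rw [h]
    simp
  · right
    -- The value group is discrete: below 1 the largest value is `exp (-1)`.
    have hle : Valued.v (a : 𝔭.adicCompletion K) ≤ exp (-1 : ℤ) := by
      by_cases h0 : Valued.v (a : 𝔭.adicCompletion K) = 0
      · rw [h0]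
        exact zero_le
      · have := (log_lt_iff_lt_exp h0 (a := 0)).mpr (by simpa using h)
        rw [← exp_log h0, exp_le_exp]
        omega
    exact NNReal.coe_le_coe.mpr ((WithZeroMulInt.toNNReal_strictMono
      (HeightOneSpectrum.one_lt_absNorm_nnreal 𝔭)).monotone
      (hle.trans (exp_neg_one_le_valued_natCast 𝔭 hp h𝔭 he)))

lemma norm_adicCompletionIntegers_le_one (a : 𝔭.adicCompletionIntegers K) :
    ‖(a : 𝔭.adicCompletion K)‖ ≤ 1 := by
  have ha : Valued.v (a : 𝔭.adicCompletion K) ≤ 1 := a.2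
  rw [FinitePlace.norm_def]
  have := (WithZeroMulInt.toNNReal_strictMono
    (HeightOneSpectrum.one_lt_absNorm_nnreal 𝔭)).monotone ha
  rw [map_one] at this
  exact_mod_cast this

lemma norm_natCast_lt_one (h𝔭 : (p : 𝓞 K) ∈ 𝔭.asIdeal) : ‖(p : 𝔭.adicCompletion K)‖ < 1 := by
  have h2 := 𝔭.valuedAdicCompletion_eq_valuation (K := K) (p : 𝓞 K)
  have h1 : Valued.v (p : 𝔭.adicCompletion K) < 1 := by
    have := (𝔭.valuation_lt_one_iff_mem (K := K) (p : 𝓞 K)).mpr h𝔭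
    rw [← h2] at this
    simpa using this
  rw [FinitePlace.norm_def]
  have := (WithZeroMulInt.toNNReal_strictMono (HeightOneSpectrum.one_lt_absNorm_nnreal 𝔭)) h1
  rw [map_one] at this
  exact_mod_cast this

open scoped Valued in
/-- The multiplicative valuation of the algebraic closure of a completion. -/
noncomputable def spectralValuation : Valuation (WeierstrassCurve.LocalClosure 𝔭) ℝ≥0 where
  toFun z := ⟨spectralNorm (𝔭.adicCompletion K) (WeierstrassCurve.LocalClosure 𝔭) z,
    spectralNorm_nonneg z⟩
  map_zero' := Subtype.ext spectralNorm_zero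
  map_one' := Subtype.ext spectralNorm_one
  map_mul' x y := Subtype.ext
    (map_mul (spectralMulAlgNorm (𝔭.adicCompletion K) (WeierstrassCurve.LocalClosure 𝔭)) x y)
  map_add_le_max' x y := isNonarchimedean_spectralNorm x y

end

/-- The map from `ℤ` to `𝓞 ℚ` is surjective, hence formally unramified. -/
lemma ramificationIdx_int_of_rat (𝔭 : HeightOneSpectrum (𝓞 ℚ)) :
    𝔭.asIdeal.ramificationIdx ℤ = 1 := by
  have := 𝔭.isPrime
  have hs : Function.Surjective (algebraMap ℤ (𝓞 ℚ)) := fun x ↦ by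
    refine ⟨Rat.ringOfIntegersEquiv x, Rat.ringOfIntegersEquiv.injective ?_⟩
    simp
  have : Algebra.FormallyUnramified ℤ (𝓞 ℚ) := Algebra.FormallyUnramified.of_surjective
    (Algebra.ofId ℤ (𝓞 ℚ)) hs
  exact Ideal.ramificationIdx_eq_one _ _

/-! ### Absence of canonical subgroups -/

namespace WeierstrassCurve

variable {K : Type*} [Field K] [NumberField K] {E : WeierstrassCurve K}
  {𝔭 : HeightOneSpectrum (𝓞 K)} {p : ℕ}

lemma exists_map_eq_minimalAt (E : WeierstrassCurve K) (𝔭 : HeightOneSpectrum (𝓞 K)) :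
    ∃ W : WeierstrassCurve (𝔭.adicCompletionIntegers K),
      W.map (algebraMap _ (LocalClosure 𝔭)) = (E.minimalAt 𝔭).baseChange (LocalClosure 𝔭) := by
  refine ⟨(E.minimalAt 𝔭).integralModel (𝔭.adicCompletionIntegers K), ?_⟩
  conv_rhs => rw [← baseChange_integralModel_eq (𝔭.adicCompletionIntegers K) (E.minimalAt 𝔭)]
  rw [baseChange, baseChange, map_map, ← IsScalarTower.algebraMap_eq]

lemma coe_spectralValuation (z : LocalClosure 𝔭) :
    (spectralValuation 𝔭 z : ℝ) = spectralNorm (𝔭.adicCompletion K) (LocalClosure 𝔭) z :=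
  rfl

lemma coe_spectralValuation_algebraMap (x : 𝔭.adicCompletion K) :
    (spectralValuation 𝔭 (algebraMap _ (LocalClosure 𝔭) x) : ℝ) = ‖x‖ := by
  open scoped Valued in
  exact spectralNorm_extends x

section

variable (hp : p ≠ 0) (h𝔭 : (p : 𝓞 K) ∈ 𝔭.asIdeal)

include hp in
lemma norm_natCast_pos : 0 < ‖(p : 𝔭.adicCompletion K)‖ := by
  have : CharZero (𝔭.adicCompletion K) := algebraRat.charZero _
  exact norm_pos_iff.mpr (Nat.cast_ne_zero.mpr hp)

include hp h𝔭 in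
-- The logarithm has base `‖p‖ < 1`, which reverses the order.
lemma valuationAt_lt_iff {x y : LocalClosure 𝔭} (hy : y ≠ 0) :
    valuationAt 𝔭 p y < valuationAt 𝔭 p x ↔ spectralValuation 𝔭 x < spectralValuation 𝔭 y := by
  have hpos {z : LocalClosure 𝔭} (hz : z ≠ 0) : (0 : ℝ) < spectralValuation 𝔭 z :=
    NNReal.coe_pos.mpr ((spectralValuation 𝔭).pos_iff.mpr hz)
  rw [valuationAt, valuationAt, if_neg hy]
  split_ifs with hx
  · simpa [hx] using (spectralValuation 𝔭).pos_iff.mpr hy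
  · rw [WithTop.coe_lt_coe, ← coe_spectralValuation, ← coe_spectralValuation,
      Real.logb_lt_logb_iff_of_base_lt_one (norm_natCast_pos hp) (norm_natCast_lt_one 𝔭 h𝔭)
        (hpos hy) (hpos hx), NNReal.coe_lt_coe]

include hp h𝔭 in
lemma valuationAt_lt_zero_iff {y : LocalClosure 𝔭} :
    valuationAt 𝔭 p y < 0 ↔ 1 < spectralValuation 𝔭 y := by
  by_cases hy : y = 0
  · simp [valuationAt, hy]
  · have h1 : valuationAt 𝔭 p (1 : LocalClosure 𝔭) = 0 := by
      rw [valuationAt, if_neg one_ne_zero, ← coe_spectralValuation, map_one]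
      simp
    rw [← h1, valuationAt_lt_iff hp h𝔭 hy, map_one]

include hp h𝔭 in
lemma PointAt.InFormalGroup.exists_coord {P : E.PointAt 𝔭} (hP : P.InFormalGroup p) (h0 : P ≠ 0) :
    ∃ w, ((E.minimalAt 𝔭).baseChange (LocalClosure 𝔭)).IsCoordAtInfinity P.parameter w P ∧
      spectralValuation 𝔭 P.parameter < 1 ∧ spectralValuation 𝔭 w < 1 := by
  rcases P with _ | ⟨x, y, h⟩
  · exact (h0 rfl).elim
  obtain ⟨h1, h2⟩ := hP
  rw [valuationAt_lt_zero_iff hp h𝔭] at h1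
  have hv : spectralValuation 𝔭 y ≠ 0 := (zero_lt_one.trans h1).ne'
  have hy : y ≠ 0 := (Valuation.ne_zero_iff _).mp hv
  rw [valuationAt_lt_iff hp h𝔭 hy] at h2
  refine ⟨-1 / y, ⟨by field_simp, ?_⟩, ?_, ?_⟩
  · rw [PointAt.parameter]
    ring
  · rw [PointAt.parameter, map_div₀, Valuation.map_neg]
    exact (div_lt_one (pos_iff_ne_zero.mpr hv)).mpr h2
  · rw [map_div₀, Valuation.map_neg, map_one]
    exact (div_lt_one (pos_iff_ne_zero.mpr hv)).mpr h1

end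

open scoped Classical in
-- The type of points depends on the curve. Leaving `V` a variable allows it to be replaced by the
-- base change of an integral model without transporting points.
lemma valuation_eq_of_model {V : WeierstrassCurve (LocalClosure 𝔭)}
    (hV : ∃ W : WeierstrassCurve (𝔭.adicCompletionIntegers K),
      W.map (algebraMap _ (LocalClosure 𝔭)) = V)
    (hp : p.Prime) (h𝔭 : (p : 𝓞 K) ∈ 𝔭.asIdeal) (he : 𝔭.asIdeal.ramificationIdx ℤ = 1)
    {P : Fin 2 → V.toAffine.Point} (hPp : ∀ i, addOrderOf (P i) = p)
    {z w : Fin 2 → LocalClosure 𝔭} (hP : ∀ i, V.IsCoordAtInfinity (z i) (w i) (P i))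
    (hz : ∀ i, spectralValuation 𝔭 (z i) < 1) (hw : ∀ i, spectralValuation 𝔭 (w i) < 1) :
    z 0 ≠ 0 ∧ spectralValuation 𝔭 (z 0) = spectralValuation 𝔭 (z 1) := by
  obtain ⟨W, rfl⟩ := hV
  have hA (a : 𝔭.adicCompletionIntegers K) :
      (spectralValuation 𝔭 (algebraMap _ (LocalClosure 𝔭) a) : ℝ) =
        ‖(a : 𝔭.adicCompletion K)‖ := by
    rw [IsScalarTower.algebraMap_apply _ (𝔭.adicCompletion K), coe_spectralValuation_algebraMap]
    rfl
  have hpv : (spectralValuation 𝔭 (p : LocalClosure 𝔭) : ℝ) = ‖(p : 𝔭.adicCompletion K)‖ := by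
    rw [← coe_spectralValuation_algebraMap, map_natCast (algebraMap _ (LocalClosure 𝔭))]
  refine valuation_parameter_eq hp.two_le (v := spectralValuation 𝔭) (fun a ↦ ?_) (fun a ↦ ?_) ?_
    hP hPp hz hw 0 1
  · rw [← NNReal.coe_le_coe, hA]
    exact norm_adicCompletionIntegers_le_one 𝔭 a
  · rw [← NNReal.coe_le_coe, ← NNReal.coe_inj, hA, hpv]
    exact norm_eq_one_or_le_norm_natCast 𝔭 hp h𝔭 he a
  · rw [← NNReal.coe_ne_zero, hpv]
    exact (norm_natCast_pos hp.ne_zero).ne'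

/-- There is no canonical subgroup at an unramified prime. -/
theorem not_hasCanonicalSubgroup_of_ramificationIdx_eq_one (hp : p.Prime)
    (h𝔭 : (p : 𝓞 K) ∈ 𝔭.asIdeal) (he : 𝔭.asIdeal.ramificationIdx ℤ = 1) :
    ¬ E.HasCanonicalSubgroup 𝔭 p := by
  classical
  rintro ⟨C, R, ⟨hR, hRp⟩, ⟨Q, ⟨hQ, hQp⟩, hlt⟩, -⟩
  have hne {P : E.PointAt 𝔭} (h : addOrderOf P = p) : P ≠ 0 := by
    rintro rfl
    rw [addOrderOf_zero] at h
    exact hp.one_lt.ne h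
  obtain ⟨w, hw, hz1, hw1⟩ := hR.exists_coord hp.ne_zero h𝔭 (hne hRp)
  obtain ⟨w', hw', hz1', hw1'⟩ := hQ.exists_coord hp.ne_zero h𝔭 (hne hQp)
  obtain ⟨h0 : Q.parameter ≠ 0, h⟩ := valuation_eq_of_model (exists_map_eq_minimalAt E 𝔭) hp h𝔭 he
    (P := ![Q, R]) (z := ![Q.parameter, R.parameter]) (w := ![w', w])
    (Fin.forall_fin_two.mpr ⟨by convert hQp; rfl, by convert hRp; rfl⟩)
    (Fin.forall_fin_two.mpr ⟨hw', hw⟩) (Fin.forall_fin_two.mpr ⟨hz1', hz1⟩)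
    (Fin.forall_fin_two.mpr ⟨hw1', hw1⟩)
  rw [valuationAt_lt_iff hp.ne_zero h𝔭 h0] at hlt
  exact hlt.ne h.symm

end WeierstrassCurve

theorem mainTheorem6 :
    (∀ (K : Type*) [Field K] [NumberField K] (E : WeierstrassCurve K) [E.IsElliptic]
      (p : ℕ) [Fact p.Prime] (𝔭 : HeightOneSpectrum (𝓞 K)),
      (p : 𝓞 K) ∈ 𝔭.asIdeal →
      𝔭.asIdeal.ramificationIdx ℤ = 1 →
      E.IsSupersingularAt 𝔭 p →
      ¬ E.HasCanonicalSubgroup 𝔭 p) ∧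
    (∀ (E : WeierstrassCurve ℚ) [E.IsElliptic]
      (p : ℕ) [Fact p.Prime] (𝔭 : HeightOneSpectrum (𝓞 ℚ)),
      (p : 𝓞 ℚ) ∈ 𝔭.asIdeal →
      ¬ E.HasCanonicalSubgroup 𝔭 p) := by
  refine ⟨fun K _ _ E _ p hp 𝔭 h𝔭 he _ ↦ ?_, fun E _ p hp 𝔭 h𝔭 ↦ ?_⟩
  · exact WeierstrassCurve.not_hasCanonicalSubgroup_of_ramificationIdx_eq_one hp.out h𝔭 he
  · exact WeierstrassCurve.not_hasCanonicalSubgroup_of_ramificationIdx_eq_one hp.out h𝔭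
      (ramificationIdx_int_of_rat 𝔭)
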